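/- Theorem. Every flotilla satisfies the Erdős–Hajnal conjecture. Here all tournaments are finite, $|T|$ is the number of vertices of a tournament $T$, and $T|X$ is the subtournament of $T$ induced by $X\subseteq V(T)$. A tournament is transitive if it has no directed cycle. A tournament $T$ contains a tournament $H$ if $H$ is isomorphic to $T|X$ for some $X\subseteq V(T)$; otherwise $T$ is $H$-free. A tournament $H$ satisfies the Erdős–Hajnal conjecture if there is $\epsilon>0$ such that every $H$-free tournament $T$ with $n$ vertices contains a transitive subtournament with at least $n^{\epsilon}$ vertices. Let $\theta=(v_1,\dots,v_n)$ be an ordering of $V(T)$. The graph of backward arcs $B(T,\theta)$ is the undirected graph with vertex set $V(T)$ in which, for $i<j$, the vertices $v_i$ and $v_j$ are adjacent if and only if $(v_j,v_i)$ is an arc of $T$. A boat is a tournament with four vertices $x,u,v,y$ and arcs $(y,x),(y,u),(v,x),(x,u),(u,v),(v,y)$; its path ordering is $(x,u,v,y)$, under which the backward arcs are $(y,u),(y,x),(v,x)$. A left boat (respectively right boat) of $B(T,\theta)$ is the subgraph induced by four vertices $v_{i_1},v_{i_2},v_{i_3},v_{i_4}$ with $i_1<i_2<i_3<i_4$ whose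 edges are exactly $v_{i_1}v_{i_3}$, $v_{i_1}v_{i_4}$, $v_{i_2}v_{i_4}$ (that is, it is the graph of backward arcs of a boat under its path ordering), where $i_3=i_2+1=i_1+2$ (respectively $i_4=i_3+1=i_2+2$). A tournament $T$ is a flotilla if there is an ordering $\theta$ of its vertices such that every connected component of $B(T,\theta)$ is a left boat or a right boat. -/

import Mathlib

universe u v

namespace FlotillaEHC

/-- A tournament on the vertex type `V`: a digraph without loops in which any two distinct
vertices are joined by exactly one of the two possible arcs. -/
structure Tournament (V : Type u) extends Digraph V where
  irrefl : ∀ a, ¬ Adj a a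
  adj_xor : ∀ a b, a ≠ b → Xor (Adj a b) (Adj b a)

namespace Tournament

variable {V : Type u} {W : Type v}

/-- The subtournament `T | X` induced by a set `X` of vertices. -/
def induce (T : Tournament V) (X : Set V) : Tournament X where
  Adj a b := T.Adj a b
  irrefl a := T.irrefl a
  adj_xor a b h := T.adj_xor a b (fun e => h (Subtype.ext e))

/-- A tournament is transitive if it has no directed cycle (no directed closed walk of positive
length). -/
def IsTransitive (T : Tournament V) : Prop :=
  ∀ a, ¬ Relation.TransGen T.Adj a a

/-- `T` contains `H` if `H` is isomorphic to `T | X` for some set `X` of vertices of `T`. -/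
def Contains (T : Tournament W) (H : Tournament V) : Prop :=
  ∃ X : Set W, Nonempty (H.Adj ≃r (T.induce X).Adj)

/-- `H` satisfies the Erdős–Hajnal conjecture: there is `ε > 0` such that every `H`-free
tournament with `n` vertices contains a transitive subtournament of size at least `n ^ ε`. -/
def SatisfiesEHC (H : Tournament V) : Prop :=
  ∃ ε : ℝ, 0 < ε ∧ ∀ (W : Type v) [Fintype W] (T : Tournament W), ¬ T.Contains H →
    ∃ X : Finset W, (T.induce (X : Set W)).IsTransitive ∧
      (Fintype.card W : ℝ) ^ ε ≤ (X.card : ℝ)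

/-- The graph of backward arcs `B(T, θ)`, for an ordering `θ = (θ 0, …, θ (n - 1))` of the
vertices. -/
def backwardGraph {n : ℕ} (T : Tournament V) (θ : Fin n ≃ V) : SimpleGraph V where
  Adj a b := (T.Adj a b ∧ θ.symm b < θ.symm a) ∨ (T.Adj b a ∧ θ.symm a < θ.symm b)
  symm := ⟨fun _ _ h => h.symm⟩
  loopless := ⟨fun a h => T.irrefl a (h.elim And.left And.left)⟩

/-- The boat `{x, u, v, y}`, with `x, u, v, y` being `0, 1, 2, 3`. Its path ordering
`(x, u, v, y)` is thus `Equiv.refl (Fin 4)`. -/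
def boat : Tournament (Fin 4) where
  Adj a b := (a, b) ∈
    ({(3, 0), (3, 1), (2, 0), (0, 1), (1, 2), (2, 3)} : Finset (Fin 4 × Fin 4))
  irrefl := by decide
  adj_xor := by unfold Xor; decide

/-- The vertices `θ (i 0), …, θ (i 3)`, listed in the order `θ`, induce in `B(T, θ)` the graph of
backward arcs of a boat under its path ordering. -/
def IsBoatAt {n : ℕ} (T : Tournament V) (θ : Fin n ≃ V) (i : Fin 4 → Fin n) : Prop :=
  StrictMono i ∧ ∀ a b, (T.backwardGraph θ).Adj (θ (i a)) (θ (i b)) ↔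
    (boat.backwardGraph (Equiv.refl (Fin 4))).Adj a b

/-- `X` is the vertex set of a left boat in `B(T, θ)`: the first three vertices are consecutive. -/
def IsLeftBoat {n : ℕ} (T : Tournament V) (θ : Fin n ≃ V) (X : Set V) : Prop :=
  ∃ i : Fin 4 → Fin n, X = Set.range (fun a => θ (i a)) ∧ T.IsBoatAt θ i ∧
    (i 1 : ℕ) = i 0 + 1 ∧ (i 2 : ℕ) = i 1 + 1

/-- `X` is the vertex set of a right boat in `B(T, θ)`: the last three vertices are consecutive. -/
def IsRightBoat {n : ℕ} (T : Tournament V) (θ : Fin n ≃ V) (X : Set V) : Prop :=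
  ∃ i : Fin 4 → Fin n, X = Set.range (fun a => θ (i a)) ∧ T.IsBoatAt θ i ∧
    (i 2 : ℕ) = i 1 + 1 ∧ (i 3 : ℕ) = i 2 + 1

/-- `θ` is a flotilla ordering of `T`: every connected component of `B(T, θ)` is a left boat or a
right boat. -/
def IsFlotillaOrdering {n : ℕ} (T : Tournament V) (θ : Fin n ≃ V) : Prop :=
  ∀ C : (T.backwardGraph θ).ConnectedComponent, T.IsLeftBoat θ C.supp ∨ T.IsRightBoat θ C.supp

/-- A flotilla is a tournament that has a flotilla ordering. -/
def IsFlotilla [Fintype V] (T : Tournament V) : Prop :=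
  ∃ θ : Fin (Fintype.card V) ≃ V, T.IsFlotillaOrdering θ

end Tournament

end FlotillaEHC

/-!
Let `H` be a flotilla and suppose that some `H`-free tournament `T` has no transitive
subtournament on `|T| ^ ε` vertices. Take a minimal set `X` of vertices of `T` with this property;
every large proper subset of `X` then contains a transitive set of size almost `|X| ^ ε`. Two such
sets cannot be complete to each other, so `X` has no complete pair consisting of a large set and a
rather large transitive set.

If large disjoint subsets of `X` always had many arcs in both directions, then `H` could be
embedded greedily. Hence there are large sets with few arcs from one to the other, and iterating
yields a sequence `S 0, …, S (n - 1)` of large parts of `X`, one for each vertex of `H` in a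
flotilla ordering, such that every vertex has few backward arcs to every part.

Now the boats of `H` are copied one by one, in such a way that all arcs between copies of
different boats are forward. Let the vertices of a left boat correspond to the parts `A, M, B, D`.
Criticality gives `x ∈ A`, `u, v ∈ B` and `y ∈ D` with arcs `u → v`, `y → u`, `y → x`, `v → x`. If
`x → u` and `v → y`, then `x, u, v, y` is a boat. Otherwise let `z` be `u` if `u → x`, and `v` if
`y → v`; for any `w ∈ M` joined to `x`, `z` and `y` by forward arcs, `z, x, w, y` is a boat. In
either case the first three vertices of the boat lie in `A ∪ M ∪ B`, perhaps not in the parts they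
belong to, which is harmless because `A, M, B` are consecutive. Reversing all arcs deals with
right boats.
-/

namespace FlotillaEHC

open Finset Function

theorem lt_of_disjoint_uIcc {α : Type*} [LinearOrder α] {a b a' b' : α}
    (h : Disjoint (Set.uIcc a b) (Set.uIcc a' b')) (hlt : a < a') : b < b' := by
  by_contra! hle
  exact Set.disjoint_left.1 h (show a ⊔ b' ∈ _ from
    ⟨inf_le_left.trans le_sup_left, sup_le_sup_left hle a⟩)
    ⟨inf_le_right.trans le_sup_right, sup_le_sup_right hlt.le b'⟩

section Counting

variable {α β ι : Type*}

theorem card_interedges_eq_sum (r : α → β → Prop) [∀ a, DecidablePred (r a)] (s : Finset α)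
    (t : Finset β) : #(Rel.interedges r s t) = ∑ a ∈ s, #{b ∈ t | r a b} := by
  simp only [Rel.interedges, card_filter, sum_product]

theorem card_interedges_swap (r : α → β → Prop) [∀ a, DecidablePred (r a)] (s : Finset α)
    (t : Finset β) : #(Rel.interedges (swap r) t s) = #(Rel.interedges r s t) :=
  card_equiv (Equiv.prodComm β α) fun x => by
    simp only [Rel.mem_interedges_iff, swap, Equiv.prodComm_apply, Prod.fst_swap, Prod.snd_swap]
    tauto

theorem card_filter_mul_le_card_interedges (r : α → β → Prop) [∀ a, DecidablePred (r a)]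
    (s : Finset α) (t : Finset β) (x : ℝ) :
    #{a ∈ s | x < #{b ∈ t | r a b}} * x ≤ #(Rel.interedges r s t) := by
  rw [card_interedges_eq_sum, Nat.cast_sum, ← nsmul_eq_mul]
  calc #{a ∈ s | x < #{b ∈ t | r a b}} • x
      ≤ ∑ a ∈ s with x < #{b ∈ t | r a b}, (#{b ∈ t | r a b} : ℝ) :=
        card_nsmul_le_sum _ _ _ fun a ha => (mem_filter.1 ha).2.le
    _ ≤ ∑ a ∈ s, (#{b ∈ t | r a b} : ℝ) :=
        sum_le_sum_of_subset_of_nonneg (filter_subset _ _) fun _ _ _ => Nat.cast_nonneg _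

theorem card_interedges_le_card_mul (r : α → β → Prop) [∀ a, DecidablePred (r a)] {s : Finset α}
    {t : Finset β} {x : ℝ} (h : ∀ a ∈ s, (#{b ∈ t | r a b} : ℝ) ≤ x) :
    (#(Rel.interedges r s t) : ℝ) ≤ #s * x := by
  rw [card_interedges_eq_sum, Nat.cast_sum, ← nsmul_eq_mul]
  exact sum_le_card_nsmul s _ x h

theorem card_le_card_mul_of_forall_exists_mem {I : Finset ι} {B : ι → Finset α} {s : Finset α}
    {x : ℝ} (hs : ∀ a ∈ s, ∃ i ∈ I, a ∈ B i) (hB : ∀ i ∈ I, (#(B i) : ℝ) ≤ x) :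
    (#s : ℝ) ≤ #I * x := by
  classical
  have hcover : s ⊆ I.biUnion B := fun a ha => mem_biUnion.2 (hs a ha)
  calc (#s : ℝ) ≤ ∑ i ∈ I, (#(B i) : ℝ) := by
        exact_mod_cast (card_le_card hcover).trans card_biUnion_le
    _ ≤ #I * x := by
        rw [← nsmul_eq_mul]
        exact sum_le_card_nsmul I _ x hB

theorem le_two_mul_mul_div {m n : ℕ} (hm : 0 < m) (hmn : m ≤ n) : n ≤ 2 * m * (n / m) := by
  have hdiv : 1 ≤ n / m := (Nat.one_le_div_iff hm).2 hmn
  have hlt : n < m * (n / m + 1) := Nat.lt_mul_div_succ n hm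
  nlinarith

theorem exists_pairwise_disjoint_card_eq [Fintype ι] (U : Finset α) {q : ℕ}
    (h : Fintype.card ι * q ≤ #U) :
    ∃ X : ι → Finset α, (∀ i, X i ⊆ U ∧ #(X i) = q) ∧ Pairwise (Disjoint on X) := by
  obtain ⟨f⟩ : Nonempty (ι × Fin q ↪ U) :=
    Embedding.nonempty_of_card_le (by simpa using h)
  let g (i : ι) : Fin q ↪ α := (Embedding.sectR i (Fin q)).trans (f.trans (Embedding.subtype _))
  refine ⟨fun i => univ.map (g i), fun i => ⟨fun a ha => ?_, by simp⟩, fun i j hij => ?_⟩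
  · obtain ⟨k, -, rfl⟩ := mem_map.1 ha
    exact (f (i, k)).2
  · refine disjoint_left.2 fun a hai haj => hij ?_
    obtain ⟨k, -, rfl⟩ := mem_map.1 hai
    obtain ⟨k', -, hk'⟩ := mem_map.1 haj
    exact (congrArg Prod.fst (f.injective (Subtype.ext hk'))).symm

theorem exists_le_forall_card_filter_le [Fintype ι] (r : ι → ι → α → α → Prop)
    [∀ i j a, DecidablePred (r i j a)] (S : ι → Finset α) {l : ℝ} (hl : 0 < l)
    (h : ∀ i j, 4 * Fintype.card ι * #(Rel.interedges (r i j) (S i) (S j)) ≤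
      l * #(S i) * #(S j)) :
    ∃ S' ≤ S, (∀ i, (#(S i) : ℝ) ≤ 2 * #(S' i)) ∧
      ∀ i j, ∀ v ∈ S' i, (#{w ∈ S' j | r i j v w} : ℝ) ≤ l * #(S' j) := by
  classical
  let IsBad (i j : ι) (v : α) : Prop := l / 2 * #(S j) < #{w ∈ S j | r i j v w}
  let S' (i : ι) : Finset α := {v ∈ S i | ∀ j, ¬IsBad i j v}
  have hbad (i j : ι) : (#{v ∈ S i | IsBad i j v} : ℝ) ≤ #(S i) / (2 * Fintype.card ι) := by
    have : Nonempty ι := ⟨i⟩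
    rcases (S j).eq_empty_or_nonempty with hj | hj
    · simp only [IsBad, hj, card_empty, filter_empty, Nat.cast_zero, mul_zero, lt_self_iff_false,
        filter_false]
      positivity
    · have hmarkov := card_filter_mul_le_card_interedges (r i j) (S i) (S j) (l / 2 * #(S j))
      have hpos : 0 < l * #(S j) := by positivity
      rw [le_div_iff₀ (by positivity)]
      refine le_of_mul_le_mul_right ?_ hpos
      calc (#{v ∈ S i | IsBad i j v} : ℝ) * (2 * Fintype.card ι) * (l * #(S j))
          = 4 * Fintype.card ι * (#{v ∈ S i | IsBad i j v} * (l / 2 * #(S j))) := by ring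
        _ ≤ 4 * Fintype.card ι * #(Rel.interedges (r i j) (S i) (S j)) := by gcongr
        _ ≤ #(S i) * (l * #(S j)) := (h i j).trans_eq (by ring)
  have hhalf (i : ι) : (#(S i) : ℝ) ≤ 2 * #(S' i) := by
    have : Nonempty ι := ⟨i⟩
    have hremoved : (#(S i \ S' i) : ℝ) ≤ #(univ : Finset ι) * (#(S i) / (2 * Fintype.card ι)) :=
      card_le_card_mul_of_forall_exists_mem (B := fun j => {v ∈ S i | IsBad i j v})
        (by simp +contextual [S']) fun j _ => hbad i j
    have hcancel : (Fintype.card ι : ℝ) * (#(S i) / (2 * Fintype.card ι)) = #(S i) / 2 := by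
      field_simp
    have hsplit : (#(S i) : ℝ) ≤ #(S i \ S' i) + #(S' i) := by
      exact_mod_cast card_le_card_sdiff_add_card
    rw [card_univ, hcancel] at hremoved
    linarith
  refine ⟨S', fun i => filter_subset _ _, hhalf, fun i j v hv => ?_⟩
  calc (#{w ∈ S' j | r i j v w} : ℝ)
      ≤ #{w ∈ S j | r i j v w} := by gcongr; exact filter_subset _ _
    _ ≤ l / 2 * #(S j) := not_lt.1 ((mem_filter.1 hv).2 j)
    _ ≤ l * #(S' j) := by nlinarith [hhalf j]

end Counting

section SparseChains

variable {α : Type*}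

open Classical in
/-- Every finite set `U` of size at least `1 / c` contains `k` pairwise disjoint subsets of size at
least `c * #U` such that `r` has density at most `l` from any of them to any earlier one. -/
def HasSparseChains (r : α → α → Prop) (k : ℕ) (l c : ℝ) : Prop :=
  ∀ U : Finset α, 1 ≤ c * #U → ∃ S : Fin k → Finset α, (∀ i, S i ⊆ U ∧ c * #U ≤ #(S i)) ∧
    ∀ i j, i < j → Disjoint (S i) (S j) ∧
      (#(Rel.interedges r (S j) (S i)) : ℝ) ≤ l * #(S j) * #(S i)

theorem hasSparseChains_zero (r : α → α → Prop) (l c : ℝ) : HasSparseChains r 0 l c :=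
  fun _ _ => ⟨Fin.elim0, fun i => i.elim0, fun i => i.elim0⟩

theorem HasSparseChains.succ {r : α → α → Prop} {k : ℕ} {l c d : ℝ}
    (hchain : HasSparseChains r k l c) (hpair : HasSparseChains r 2 (l * c) d) (hl : 0 ≤ l)
    (hc₀ : 0 ≤ c) (hc₁ : c ≤ 1) (hd : 0 ≤ d) : HasSparseChains r (k + 1) l (c * d) := by
  classical
  intro U hU
  have hcd : c * d * #U ≤ d * #U := by
    rw [mul_assoc]
    exact mul_le_of_le_one_left (by positivity) hc₁
  obtain ⟨P, hP, hPsparse⟩ := hpair U (hU.trans hcd)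
  obtain ⟨hdisj, hsparse⟩ := hPsparse 0 1 Fin.zero_lt_one
  have hcB : c * d * #U ≤ c * #(P 1) := by
    rw [mul_assoc]
    exact mul_le_mul_of_nonneg_left (hP 1).2 hc₀
  obtain ⟨S, hS, hSsparse⟩ := hchain (P 1) (hU.trans hcB)
  have hfirst (j : Fin k) : Disjoint (P 0) (S j) ∧
      (#(Rel.interedges r (S j) (P 0)) : ℝ) ≤ l * #(S j) * #(P 0) := by
    refine ⟨hdisj.mono_right (hS j).1, ?_⟩
    calc (#(Rel.interedges r (S j) (P 0)) : ℝ)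
        ≤ #(Rel.interedges r (P 1) (P 0)) := by
          exact_mod_cast card_le_card (Rel.interedges_mono (hS j).1 le_rfl)
      _ ≤ l * (c * #(P 1)) * #(P 0) := by rwa [← mul_assoc l]
      _ ≤ l * #(S j) * #(P 0) := by gcongr; exact (hS j).2
  refine ⟨Fin.cons (P 0) S, ?_, ?_⟩
  · rw [Fin.forall_fin_succ]
    exact ⟨⟨(hP 0).1, hcd.trans (hP 0).2⟩,
      fun i => ⟨(hS i).1.trans (hP 1).1, hcB.trans (hS i).2⟩⟩
  · simp only [Fin.forall_fin_succ, Fin.cons_zero, Fin.cons_succ,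
      IsEmpty.forall_iff, true_and, Fin.succ_pos, forall_const, Fin.not_lt_zero,
      Fin.succ_lt_succ_iff]
    exact ⟨hfirst, hSsparse⟩

end SparseChains

namespace Tournament

section Basic

variable {V W : Type*} {T : Tournament W} {a b : W}

theorem ne_of_adj (h : T.Adj a b) : a ≠ b := by
  rintro rfl
  exact T.irrefl _ h

theorem not_adj_iff (h : a ≠ b) : ¬T.Adj a b ↔ T.Adj b a := by
  rcases T.adj_xor a b h with ⟨hab, hba⟩ | ⟨hba, hab⟩ <;> simp [hab, hba]

theorem adj_asymm (hab : T.Adj a b) : ¬T.Adj b a :=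
  (not_adj_iff (ne_of_adj hab).symm).2 hab

theorem adj_or_adj (h : a ≠ b) : T.Adj a b ∨ T.Adj b a :=
  or_iff_not_imp_left.2 (not_adj_iff h).1

theorem contains_of_forall_adj {H : Tournament V} {T : Tournament W} (f : V → W)
    (hf : ∀ a b, H.Adj a b → T.Adj (f a) (f b)) : T.Contains H := by
  have hinj : Injective f := fun a b hab => by
    by_contra hne
    rcases adj_or_adj hne with h | h <;> exact ne_of_adj (hf _ _ h) (by rw [hab])
  have hiff (a b : V) : T.Adj (f a) (f b) ↔ H.Adj a b := by
    refine ⟨fun h => ?_, hf a b⟩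
    have hne : a ≠ b := fun hab => ne_of_adj h (congrArg f hab)
    exact (adj_or_adj hne).resolve_right fun hba => adj_asymm h (hf _ _ hba)
  exact ⟨Set.range f, ⟨⟨Equiv.ofInjective f hinj, fun {a b} => hiff a b⟩⟩⟩

/-- The tournament with all arcs reversed. -/
def reverse (T : Tournament W) : Tournament W where
  Adj a b := T.Adj b a
  irrefl := T.irrefl
  adj_xor a b h := T.adj_xor b a h.symm

/-- The arc relation is transitive on `X`. For a tournament this amounts to having no directed cycle
inside `X`, see `IsTransitiveOn.isTransitive_induce`. -/
def IsTransitiveOn (T : Tournament W) (X : Finset W) : Prop :=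
  ∀ a ∈ X, ∀ b ∈ X, ∀ c ∈ X, T.Adj a b → T.Adj b c → T.Adj a c

/-- All arcs between `A` and `B` go from `A` to `B`. -/
def IsCompleteTo (T : Tournament W) (A B : Finset W) : Prop :=
  ∀ a ∈ A, ∀ b ∈ B, T.Adj a b

variable {X Y A B : Finset W}

theorem IsTransitiveOn.mono (h : T.IsTransitiveOn X) (hY : Y ⊆ X) : T.IsTransitiveOn Y :=
  fun a ha b hb c hc => h a (hY ha) b (hY hb) c (hY hc)

theorem IsTransitiveOn.reverse (h : T.IsTransitiveOn X) : T.reverse.IsTransitiveOn X :=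
  fun a ha b hb c hc hab hbc => h c hc b hb a ha hbc hab

theorem IsTransitiveOn.isTransitive_induce (h : T.IsTransitiveOn X) :
    (T.induce (X : Set W)).IsTransitive := by
  intro a ha
  have hadj (b) (hab : Relation.TransGen (T.induce (X : Set W)).Adj a b) : T.Adj a b := by
    induction hab with
    | single h => exact h
    | @tail b c _ hbc hab => exact h a a.2 b b.2 c c.2 hab hbc
  exact T.irrefl _ (hadj a ha)

theorem isTransitiveOn_of_card_le_two (h : #X ≤ 2) : T.IsTransitiveOn X := by
  intro a ha b hb c hc hab hbc
  by_contra hac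
  have hne : a ≠ c := by
    rintro rfl
    exact adj_asymm hab hbc
  exact h.not_gt (two_lt_card.2 ⟨a, ha, b, hb, c, hc, ne_of_adj hab, hne, ne_of_adj hbc⟩)

theorem IsCompleteTo.disjoint (h : T.IsCompleteTo A B) : Disjoint A B :=
  disjoint_left.2 fun a ha hb => T.irrefl _ (h a ha a hb)

theorem IsCompleteTo.isTransitiveOn_union [DecidableEq W] (h : T.IsCompleteTo A B)
    (hA : T.IsTransitiveOn A) (hB : T.IsTransitiveOn B) : T.IsTransitiveOn (A ∪ B) := by
  intro a ha b hb c hc hab hbc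
  rcases mem_union.1 ha with ha | ha <;> rcases mem_union.1 hb with hb | hb <;>
    rcases mem_union.1 hc with hc | hc
  · exact hA a ha b hb c hc hab hbc
  · exact h a ha c hc
  · exact absurd hbc (adj_asymm (h c hc b hb))
  · exact h a ha c hc
  · exact absurd hab (adj_asymm (h b hb a ha))
  · exact absurd hab (adj_asymm (h b hb a ha))
  · exact absurd hbc (adj_asymm (h c hc b hb))
  · exact hB a ha b hb c hc hab hbc

theorem IsTransitiveOn.exists_forall_adj (h : T.IsTransitiveOn X) (hX : X.Nonempty) :
    ∃ x ∈ X, ∀ b ∈ X, b ≠ x → T.Adj x b := by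
  classical
  obtain ⟨x, hx, hmax⟩ := X.exists_max_image (fun x => #{b ∈ X | T.Adj x b}) hX
  refine ⟨x, hx, fun b hb hbx => ?_⟩
  by_contra hxb
  replace hbx : T.Adj b x := (not_adj_iff hbx.symm).1 hxb
  refine (hmax b hb).not_gt (card_lt_card ?_)
  refine (ssubset_iff_of_subset fun c hc => ?_).2 ⟨x, by simp [hx, hbx], by simp [T.irrefl]⟩
  rw [mem_filter] at hc ⊢
  exact ⟨hc.1, h b hb x hx c hc.1 hbx hc.2⟩

theorem IsTransitiveOn.exists_isCompleteTo_sdiff [DecidableEq W] (h : T.IsTransitiveOn X) {k : ℕ}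
    (hk : k ≤ #X) : ∃ Y ⊆ X, #Y = k ∧ T.IsCompleteTo Y (X \ Y) := by
  induction k with
  | zero => exact ⟨∅, by simp, by simp, by simp [IsCompleteTo]⟩
  | succ k ih =>
    obtain ⟨Y, hY, hcard, hcomplete⟩ := ih (by omega)
    have hne : (X \ Y).Nonempty := by
      rw [← card_pos, card_sdiff_of_subset hY]
      omega
    obtain ⟨x, hx, hsource⟩ := (h.mono sdiff_subset).exists_forall_adj hne
    obtain ⟨hxX, hxY⟩ := mem_sdiff.1 hx
    refine ⟨insert x Y, insert_subset hxX hY, by rw [card_insert_of_notMem hxY, hcard], ?_⟩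
    intro a ha b hb
    simp only [mem_sdiff, mem_insert, not_or] at hb
    have hbY : b ∈ X \ Y := mem_sdiff.2 ⟨hb.1, hb.2.2⟩
    rcases mem_insert.1 ha with rfl | ha
    · exact hsource b hbY hb.2.1
    · exact hcomplete a ha b hbY

end Basic

section Embedding

variable {V W : Type*}

open Classical in
/-- Large disjoint subsets of `U` have positive density of arcs in both directions. -/
def IsBidense (T : Tournament W) (U : Finset W) (l s : ℝ) : Prop :=
  ∀ A ⊆ U, ∀ B ⊆ U, Disjoint A B → s ≤ #A → s ≤ #B → l * #A * #B < #(Rel.interedges T.Adj A B)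

/-- The vertices `v`, `w` of `T` are joined in the same direction as the vertices `a`, `b`
of `H`. -/
def SameArc (H : Tournament V) (T : Tournament W) (a b : V) (v w : W) : Prop :=
  (H.Adj a b → T.Adj v w) ∧ (H.Adj b a → T.Adj w v)

variable {H : Tournament V} {T : Tournament W} {U A B : Finset W} {l s : ℝ}

open Classical in
theorem IsBidense.lt_card_interedges_sameArc (h : T.IsBidense U l s) (hA : A ⊆ U) (hB : B ⊆ U)
    (hAB : Disjoint A B) (hsA : s ≤ #A) (hsB : s ≤ #B) (a b : V) :
    l * #A * #B < #(Rel.interedges (SameArc H T a b) A B) := by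
  by_cases hab : H.Adj a b
  · have hsub : Rel.interedges T.Adj A B ⊆ Rel.interedges (SameArc H T a b) A B := fun x hx => by
      rw [Rel.mem_interedges_iff] at hx ⊢
      exact ⟨hx.1, hx.2.1, fun _ => hx.2.2, fun hba => absurd hba (adj_asymm hab)⟩
    exact (h A hA B hB hAB hsA hsB).trans_le (by exact_mod_cast card_le_card hsub)
  · have hsub : Rel.interedges (swap T.Adj) A B ⊆ Rel.interedges (SameArc H T a b) A B :=
      fun x hx => by
        rw [Rel.mem_interedges_iff] at hx ⊢
        exact ⟨hx.1, hx.2.1, fun hab' => absurd hab' hab, fun _ => hx.2.2⟩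
    calc l * #A * #B = l * #B * #A := mul_right_comm _ _ _
      _ < #(Rel.interedges T.Adj B A) := h B hB A hA hAB.symm hsB hsA
      _ = #(Rel.interedges (swap T.Adj) A B) := by rw [card_interedges_swap]
      _ ≤ #(Rel.interedges (SameArc H T a b) A B) := by exact_mod_cast card_le_card hsub

open Classical in
theorem IsBidense.exists_forall_le_card_sameArc (h : T.IsBidense U l s) {X : V → Finset W} {a : V}
    {I : Finset V} (haU : X a ⊆ U) (hIU : ∀ i ∈ I, X i ⊆ U)
    (hdisj : ∀ i ∈ I, Disjoint (X a) (X i)) (hs : ∀ i ∈ I, s ≤ #(X i)) (ha : #I * s < #(X a)) :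
    ∃ v ∈ X a, ∀ i ∈ I, l * #(X i) ≤ #{w ∈ X i | SameArc H T a i v w} := by
  by_contra! hcon
  let bad (i : V) : Finset W := {v ∈ X a | (#{w ∈ X i | SameArc H T a i v w} : ℝ) < l * #(X i)}
  obtain ⟨i, hi, hbig⟩ : ∃ i ∈ I, s < #(bad i) := by
    by_contra! hsmall
    exact ha.not_ge <| card_le_card_mul_of_forall_exists_mem (fun v hv => by
      obtain ⟨i, hi, hiv⟩ := hcon v hv
      exact ⟨i, hi, mem_filter.2 ⟨hv, hiv⟩⟩) hsmall
  have hbad : bad i ⊆ X a := filter_subset _ _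
  have hdense := h.lt_card_interedges_sameArc (H := H) (hbad.trans haU) (hIU i hi)
    ((hdisj i hi).mono_left hbad) hbig.le (hs i hi) a i
  refine hdense.not_ge ?_
  rw [mul_comm l, mul_assoc]
  exact card_interedges_le_card_mul _ fun v hv => (mem_filter.1 hv).2.le

theorem forall_adj_update [DecidableEq V] {a : V} {I : Finset V} (ha : a ∉ I) {φ : V → W} {v : W}
    (hφ : ∀ i ∈ I, ∀ j ∈ I, H.Adj i j → T.Adj (φ i) (φ j))
    (hv : ∀ i ∈ I, SameArc H T a i v (φ i)) :
    ∀ i ∈ insert a I, ∀ j ∈ insert a I, H.Adj i j → T.Adj (update φ a v i) (update φ a v j) := by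
  have hne {i : V} (hi : i ∈ I) : i ≠ a := ne_of_mem_of_not_mem hi ha
  simp only [forall_mem_insert, update_self]
  refine ⟨⟨fun h => absurd h (H.irrefl a), fun i hi => ?_⟩, fun i hi => ⟨?_, fun j hj => ?_⟩⟩
  · rw [update_of_ne (hne hi)]
    exact (hv i hi).1
  · rw [update_of_ne (hne hi)]
    exact (hv i hi).2
  · rw [update_of_ne (hne hi), update_of_ne (hne hj)]
    exact hφ i hi j hj

theorem IsBidense.exists_map (h : T.IsBidense U l s) (hl₀ : 0 < l) (hl₁ : l ≤ 1) (hs : 0 < s)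
    (I : Finset V) (X : V → Finset W) (hXU : ∀ i ∈ I, X i ⊆ U)
    (hdisj : (I : Set V).Pairwise (Disjoint on X))
    (hX : ∀ i ∈ I, #I * s ≤ l ^ #I * #(X i)) [Nonempty W] :
    ∃ φ : V → W, (∀ i ∈ I, φ i ∈ X i) ∧
      ∀ i ∈ I, ∀ j ∈ I, H.Adj i j → T.Adj (φ i) (φ j) := by
  classical
  induction I using Finset.induction_on generalizing X with
  | empty => exact ⟨fun _ => Classical.arbitrary W, by simp, by simp⟩
  | insert a I ha ih =>
    rw [card_insert_of_notMem ha] at hX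
    have hlarge : ∀ i ∈ insert a I, #I * s + s ≤ #(X i) := fun i hi =>
      calc #I * s + s = ↑(#I + 1) * s := by push_cast; ring
        _ ≤ l ^ (#I + 1) * #(X i) := hX i hi
        _ ≤ #(X i) := mul_le_of_le_one_left (by positivity) (pow_le_one₀ hl₀.le hl₁)
    have hmem {i : V} (hi : i ∈ I) : i ∈ insert a I := mem_insert_of_mem hi
    have hne {i : V} (hi : i ∈ I) : i ≠ a := ne_of_mem_of_not_mem hi ha
    obtain ⟨v, hv, hcard⟩ := h.exists_forall_le_card_sameArc (H := H) (X := X) (I := I)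
      (hXU a (mem_insert_self a I)) (fun i hi => hXU i (hmem hi))
      (fun i hi => hdisj (mem_insert_self a I) (hmem hi) (hne hi).symm)
      (fun i hi => (le_add_of_nonneg_left (by positivity)).trans (hlarge i (hmem hi)))
      ((lt_add_of_pos_right _ hs).trans_le (hlarge a (mem_insert_self a I)))
    let X' (i : V) : Finset W := {w ∈ X i | SameArc H T a i v w}
    have hX' (i : V) : X' i ⊆ X i := filter_subset _ _
    obtain ⟨φ, hφX, hφ⟩ := ih X' (fun i hi => (hX' i).trans (hXU i (hmem hi)))
      (fun i hi j hj hij => (hdisj (hmem hi) (hmem hj) hij).mono (hX' i) (hX' j))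
      fun i hi => calc
        #I * s ≤ ↑(#I + 1) * s := by gcongr; simp
        _ ≤ l ^ #I * (l * #(X i)) := by rw [← mul_assoc, ← pow_succ]; exact hX i (hmem hi)
        _ ≤ l ^ #I * #(X' i) := by gcongr; exact hcard i hi
    have hφv : ∀ i ∈ I, SameArc H T a i v (φ i) := fun i hi => (mem_filter.1 (hφX i hi)).2
    refine ⟨update φ a v, ?_, forall_adj_update ha hφ hφv⟩
    rw [forall_mem_insert, update_self]
    exact ⟨hv, fun i hi => by rw [update_of_ne (hne hi)]; exact hX' i (hφX i hi)⟩

theorem IsBidense.contains [Fintype V] (h : T.IsBidense U l s) (hl₀ : 0 < l) (hl₁ : l ≤ 1)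
    (hs : 0 < s) (hU : U.Nonempty) {q : ℕ} (hqU : Fintype.card V * q ≤ #U)
    (hq : Fintype.card V * s ≤ l ^ Fintype.card V * q) : T.Contains H := by
  have : Nonempty W := hU.to_type
  obtain ⟨X, hX, hdisj⟩ := exists_pairwise_disjoint_card_eq U hqU
  obtain ⟨φ, -, hφ⟩ := h.exists_map (H := H) hl₀ hl₁ hs univ X (fun i _ => (hX i).1)
    (hdisj.set_pairwise _) fun i _ => by rwa [(hX i).2, card_univ]
  exact contains_of_forall_adj φ fun a b => hφ a (mem_univ a) b (mem_univ b)

theorem hasSparseChains_two_of_not_contains [Fintype V] (hT : ¬T.Contains H) (hl₀ : 0 < l)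
    (hl₁ : l ≤ 1) :
    HasSparseChains T.Adj 2 l (l ^ Fintype.card V / (2 * (Fintype.card V + 1) ^ 2)) := by
  set k := Fintype.card V
  set d : ℝ := l ^ k / (2 * (k + 1) ^ 2) with hd
  have hd₀ : 0 < d := by positivity
  intro U hU
  have hkU : k + 1 ≤ #U := by
    have hlU : l ^ k * #U ≤ #U := mul_le_of_le_one_left (by positivity) (pow_le_one₀ hl₀.le hl₁)
    rw [hd, div_mul_eq_mul_div, one_le_div₀ (by positivity)] at hU
    have hk : (1 : ℝ) ≤ k + 1 := by simp
    have hkU : (k + 1 : ℝ) ≤ #U := by nlinarith [hk]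
    exact_mod_cast hkU
  have hUpos : 0 < #U := k.succ_pos.trans_le hkU
  have hnot : ¬T.IsBidense U l (d * #U) := fun h => by
    refine hT (h.contains (q := #U / (k + 1)) hl₀ hl₁ (by positivity) (card_pos.1 hUpos)
      ((Nat.mul_le_mul_right _ k.le_succ).trans (Nat.mul_div_le _ _)) ?_)
    have hUq : (#U : ℝ) ≤ 2 * (k + 1) * ↑(#U / (k + 1)) := by
      exact_mod_cast le_two_mul_mul_div k.succ_pos hkU
    calc k * (d * #U) ≤ (k + 1) * (d * (2 * (k + 1) * ↑(#U / (k + 1)))) := by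
          gcongr
          simp
      _ = l ^ k * ↑(#U / (k + 1)) := by
          rw [hd]
          field_simp
  simp only [IsBidense, not_forall, not_lt] at hnot
  obtain ⟨A, hA, B, hB, hAB, hdA, hdB, hsparse⟩ := hnot
  refine ⟨![B, A], Fin.forall_fin_two.2 ⟨⟨hB, hdB⟩, hA, hdA⟩, fun i j hij => ?_⟩
  obtain ⟨rfl, rfl⟩ : i = 0 ∧ j = 1 := by omega
  exact ⟨hAB.symm, hsparse⟩

theorem exists_hasSparseChains {V : Type u} [Finite V] (H : Tournament V) (k : ℕ) (hl₀ : 0 < l)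
    (hl₁ : l ≤ 1) :
    ∃ c : ℝ, 0 < c ∧ c ≤ 1 ∧ ∀ {W : Type v} (T : Tournament W), ¬T.Contains H →
      HasSparseChains T.Adj k l c := by
  have := Fintype.ofFinite V
  induction k with
  | zero => exact ⟨1, one_pos, le_rfl, fun T _ => hasSparseChains_zero T.Adj l 1⟩
  | succ k ih =>
    obtain ⟨c, hc₀, hc₁, hchain⟩ := ih
    have hlc : l * c ≤ 1 := mul_le_one₀ hl₁ hc₀.le hc₁
    set d : ℝ := (l * c) ^ Fintype.card V / (2 * (Fintype.card V + 1) ^ 2)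
    have hd : d ≤ 1 := by
      have hk : (1 : ℝ) ≤ Fintype.card V + 1 := by simp
      rw [div_le_one₀ (by positivity)]
      calc (l * c) ^ Fintype.card V ≤ 1 := pow_le_one₀ (by positivity) hlc
        _ ≤ 2 * (Fintype.card V + 1) ^ 2 := by nlinarith [hk]
    exact ⟨c * d, by positivity, mul_le_one₀ hc₁ (by positivity) hd, fun T hT =>
      (hchain T hT).succ (hasSparseChains_two_of_not_contains hT (by positivity) hlc) hl₀.le
        hc₀.le hc₁ (by positivity)⟩

end Embedding

section Smooth

variable {ι W : Type*} [LinearOrder ι]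

/-- The arc between the vertex `v` in position `i` and the vertex `w` in position `j`, if `i ≠ j`,
is directed from the smaller position to the larger one. -/
def IsForward (T : Tournament W) (i j : ι) (v w : W) : Prop :=
  (i < j → T.Adj v w) ∧ (j < i → T.Adj w v)

open Classical in
/-- Every vertex of a part is joined by backward arcs to at most a proportion `l` of any part. -/
def IsSmooth (T : Tournament W) (S : ι → Finset W) (l : ℝ) : Prop :=
  ∀ i j, ∀ v ∈ S i, (#{w ∈ S j | ¬T.IsForward i j v w} : ℝ) ≤ l * #(S j)

variable {T : Tournament W} {S : ι → Finset W} {l : ℝ}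

theorem isForward_comm (i j : ι) {v w : W} : T.IsForward i j v w ↔ T.IsForward j i w v :=
  and_comm

open Classical in
theorem card_interedges_not_isForward_le (hl : 0 ≤ l)
    (h : ∀ i j, i < j → Disjoint (S i) (S j) ∧
      (#(Rel.interedges T.Adj (S j) (S i)) : ℝ) ≤ l * #(S j) * #(S i)) (i j : ι) :
    (#(Rel.interedges (fun v w => ¬T.IsForward i j v w) (S i) (S j)) : ℝ) ≤
      l * #(S i) * #(S j) := by
  wlog hij : i ≤ j generalizing i j
  · rw [← card_interedges_swap, mul_right_comm]
    simpa only [swap, isForward_comm i j] using this j i (le_of_not_ge hij)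
  obtain rfl | hij := hij.eq_or_lt
  · simp only [IsForward, lt_irrefl, IsEmpty.forall_iff, and_self, not_true_eq_false,
      Rel.interedges, filter_false, card_empty, Nat.cast_zero]
    positivity
  obtain ⟨hdisj, hsparse⟩ := h i j hij
  have hback : Rel.interedges (fun v w => ¬T.IsForward i j v w) (S i) (S j) ⊆
      Rel.interedges (swap T.Adj) (S i) (S j) := fun x hx => by
    simp only [Rel.mem_interedges_iff, IsForward, hij, hij.not_gt, forall_const,
      IsEmpty.forall_iff, and_true] at hx
    exact Rel.mem_interedges_iff.2
      ⟨hx.1, hx.2.1, (not_adj_iff (disjoint_iff_ne.1 hdisj _ hx.1 _ hx.2.1)).1 hx.2.2⟩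
  calc (#(Rel.interedges (fun v w => ¬T.IsForward i j v w) (S i) (S j)) : ℝ)
      ≤ #(Rel.interedges (swap T.Adj) (S i) (S j)) := by exact_mod_cast card_le_card hback
    _ = #(Rel.interedges T.Adj (S j) (S i)) := by rw [card_interedges_swap]
    _ ≤ l * #(S i) * #(S j) := by rwa [mul_right_comm]

theorem exists_isSmooth {V : Type u} [Finite V] (H : Tournament V) (k : ℕ) (hl₀ : 0 < l)
    (hl₁ : l ≤ 1) :
    ∃ c : ℝ, 0 < c ∧ c ≤ 1 ∧ ∀ {W : Type v} (T : Tournament W), ¬T.Contains H →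
      ∀ U : Finset W, 1 ≤ c * #U → ∃ S : Fin k → Finset W, (∀ i, S i ⊆ U ∧ c * #U ≤ #(S i)) ∧
        Pairwise (Disjoint on S) ∧ T.IsSmooth S l := by
  classical
  have hl' : l / (4 * (k + 1)) ≤ 1 := by
    rw [div_le_one₀ (by positivity)]
    linarith [k.cast_nonneg (α := ℝ)]
  obtain ⟨c, hc₀, hc₁, hchain⟩ := exists_hasSparseChains H k (by positivity) hl'
  refine ⟨c / 2, by positivity, by linarith, fun {W} T hT U hU => ?_⟩
  obtain ⟨S, hS, hsparse⟩ := hchain T hT U (by linarith)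
  obtain ⟨S', hS', hhalf, hsmooth⟩ := exists_le_forall_card_filter_le
    (fun i j v w => ¬T.IsForward i j v w) S hl₀ fun i j => calc
      4 * (Fintype.card (Fin k) : ℝ) * #(Rel.interedges (fun v w => ¬T.IsForward i j v w) _ _)
        ≤ 4 * (k + 1) * (l / (4 * (k + 1)) * #(S i) * #(S j)) := by
          rw [Fintype.card_fin]
          gcongr
          · linarith
          · exact card_interedges_not_isForward_le (by positivity) hsparse i j
      _ = l * #(S i) * #(S j) := by field_simp
  have hdisj : Pairwise (Disjoint on S) :=
    (pairwise_disjoint_on S).2 fun i j hij => (hsparse i j hij).1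
  refine ⟨S', fun i => ⟨(hS' i).trans (hS i).1, ?_⟩, fun i j hij =>
    (hdisj hij).mono (hS' i) (hS' j), hsmooth⟩
  linarith [(hS i).2, hhalf i]

theorem IsSmooth.card_le_of_forall_exists_not_isForward (h : T.IsSmooth S l) {F : Finset (ι × W)}
    (hF : ∀ x ∈ F, x.2 ∈ S x.1) {j : ι} {A : Finset W} (hA : A ⊆ S j)
    (hback : ∀ w ∈ A, ∃ x ∈ F, ¬T.IsForward x.1 j x.2 w) : (#A : ℝ) ≤ #F * (l * #(S j)) := by
  classical
  refine card_le_card_mul_of_forall_exists_mem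
    (B := fun x => {w ∈ S j | ¬T.IsForward x.1 j x.2 w}) (fun w hw => ?_) fun x hx => ?_
  · obtain ⟨x, hx, hxw⟩ := hback w hw
    exact ⟨x, hx, mem_filter.2 ⟨hA hw, hxw⟩⟩
  · convert h x.1 j x.2 (hF x hx)

theorem IsSmooth.exists_forall_isForward (h : T.IsSmooth S l) {F : Finset (ι × W)}
    (hF : ∀ x ∈ F, x.2 ∈ S x.1) {j : ι} {A : Finset W} (hA : A ⊆ S j)
    (hcard : #F * (l * #(S j)) < #A) : ∃ w ∈ A, ∀ x ∈ F, T.IsForward x.1 j x.2 w := by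
  by_contra! hback
  exact (h.card_le_of_forall_exists_not_isForward hF hA hback).not_gt hcard

theorem IsSmooth.exists_isForward_three (h : T.IsSmooth S l) (hl : 0 ≤ l) {p q r m : ι}
    {x y z : W} (hx : x ∈ S p) (hz : z ∈ S q) (hy : y ∈ S r) {A : Finset W} (hA : A ⊆ S m)
    (hcard : 3 * (l * #(S m)) < #A) :
    ∃ w ∈ A, T.IsForward p m x w ∧ T.IsForward q m z w ∧ T.IsForward r m y w := by
  classical
  obtain ⟨w, hw, hforward⟩ := h.exists_forall_isForward (F := {(p, x), (q, z), (r, y)})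
    (by simp [hx, hy, hz]) hA (lt_of_le_of_lt (by
      gcongr
      exact_mod_cast card_le_three) hcard)
  simp only [forall_mem_insert, mem_singleton, forall_eq] at hforward
  exact ⟨w, hw, hforward⟩

end Smooth

section Critical

variable {W : Type*} {T : Tournament W} {X Y Z : Finset W} {ε d : ℝ}

/-- `X` is a minimal set of vertices without a transitive subset of size at least `#X ^ ε`. -/
structure IsCritical (T : Tournament W) (ε : ℝ) (X : Finset W) : Prop where
  pos : 0 < ε
  card_lt : ∀ Y ⊆ X, T.IsTransitiveOn Y → (#Y : ℝ) < (#X : ℝ) ^ ε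
  exists_le_card : ∀ Z ⊂ X, ∃ Y ⊆ Z, T.IsTransitiveOn Y ∧ (#Z : ℝ) ^ ε ≤ #Y

theorem exists_isCritical [Fintype W] (hε : 0 < ε)
    (h : ∀ Y, T.IsTransitiveOn Y → (#Y : ℝ) < (Fintype.card W : ℝ) ^ ε) :
    ∃ X, T.IsCritical ε X := by
  obtain ⟨X, -, hX⟩ := exists_minimal_le_of_wellFoundedLT
    (fun X : Finset W => ∀ Y ⊆ X, T.IsTransitiveOn Y → (#Y : ℝ) < (#X : ℝ) ^ ε) univ
    fun Y _ => h Y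
  refine ⟨X, hε, hX.prop, fun Z hZ => ?_⟩
  have hZ := hX.not_prop_of_lt hZ
  push Not at hZ
  exact hZ

namespace IsCritical

theorem reverse (h : T.IsCritical ε X) : T.reverse.IsCritical ε X where
  pos := h.pos
  card_lt Y hY hT := h.card_lt Y hY hT.reverse
  exists_le_card Z hZ :=
    let ⟨Y, hY, hT, hcard⟩ := h.exists_le_card Z hZ
    ⟨Y, hY, hT.reverse, hcard⟩

theorem two_lt (h : T.IsCritical ε X) : 2 < (#X : ℝ) ^ ε := by
  rcases le_or_gt 2 #X with hX | hX
  · obtain ⟨Y, hY, hcard⟩ := exists_subset_card_eq hX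
    exact_mod_cast hcard ▸ h.card_lt Y hY (isTransitiveOn_of_card_le_two hcard.le)
  · have hlt := h.card_lt X Subset.rfl (isTransitiveOn_of_card_le_two hX.le)
    interval_cases #X <;> simp [h.pos.ne'] at hlt

theorem one_lt_mul_card (h : T.IsCritical ε X) (hd : 0 < d) (hdε : 9 / 10 ≤ d ^ ε) :
    1 < d * #X := by
  by_contra! hle
  have hrpow : d ^ ε * (#X : ℝ) ^ ε ≤ 1 := by
    rw [← Real.mul_rpow hd.le (Nat.cast_nonneg _)]
    exact Real.rpow_le_one (by positivity) hle h.pos.le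
  nlinarith [h.two_lt]

theorem exists_isTransitiveOn (h : T.IsCritical ε X) (hd : 0 < d) (hdε : 9 / 10 ≤ d ^ ε)
    (hZ : Z ⊂ X) (hcard : d * #X ≤ #Z) :
    ∃ Y ⊆ Z, T.IsTransitiveOn Y ∧ 9 / 10 * (#X : ℝ) ^ ε ≤ #Y := by
  obtain ⟨Y, hY, hT, hle⟩ := h.exists_le_card Z hZ
  refine ⟨Y, hY, hT, ?_⟩
  calc 9 / 10 * (#X : ℝ) ^ ε ≤ d ^ ε * (#X : ℝ) ^ ε := by gcongr
    _ = (d * #X) ^ ε := (Real.mul_rpow hd.le (Nat.cast_nonneg _)).symm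
    _ ≤ (#Z : ℝ) ^ ε := by gcongr; exact h.pos.le
    _ ≤ #Y := hle

theorem card_lt_of_isCompleteTo (h : T.IsCritical ε X) (hd : 0 < d) (hdε : 9 / 10 ≤ d ^ ε)
    (hY : Y ⊆ X) (hT : T.IsTransitiveOn Y) (hcard : 3 / 10 * (#X : ℝ) ^ ε ≤ #Y) (hZ : Z ⊆ X)
    (hZY : T.IsCompleteTo Z Y) : (#Z : ℝ) < d * #X := by
  classical
  by_contra! hle
  have hYpos : (0 : ℝ) < #Y := by linarith [h.two_lt]
  obtain ⟨y, hy⟩ : Y.Nonempty := card_pos.1 (by exact_mod_cast hYpos)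
  have hZX : Z ⊂ X := (ssubset_iff_of_subset hZ).2
    ⟨y, hY hy, fun hyZ => disjoint_left.1 hZY.disjoint hyZ hy⟩
  obtain ⟨Y', hY'Z, hT', hcard'⟩ := h.exists_isTransitiveOn hd hdε hZX hle
  have hY'Y : T.IsCompleteTo Y' Y := fun a ha => hZY a (hY'Z ha)
  have hunion := h.card_lt (Y' ∪ Y) (union_subset (hY'Z.trans hZ) hY)
    (hY'Y.isTransitiveOn_union hT' hT)
  rw [card_union_of_disjoint hY'Y.disjoint] at hunion
  push_cast at hunion
  linarith [h.two_lt]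

open Classical in
theorem le_card_filter_exists_adj (h : T.IsCritical ε X) (hd : 0 < d) (hdε : 9 / 10 ≤ d ^ ε)
    (hY : Y ⊆ X) (hT : T.IsTransitiveOn Y) (hcard : 3 / 10 * (#X : ℝ) ^ ε ≤ #Y) (hZ : Z ⊆ X)
    (hYZ : Disjoint Y Z) (hZcard : 2 * (d * #X) ≤ #Z) :
    d * #X ≤ #{z ∈ Z | ∃ y ∈ Y, T.Adj y z} := by
  have hcomplete : T.IsCompleteTo {z ∈ Z | ¬∃ y ∈ Y, T.Adj y z} Y := fun z hz y hy => by
    obtain ⟨hzZ, hzY⟩ := mem_filter.1 hz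
    exact (not_adj_iff (disjoint_iff_ne.1 hYZ y hy z hzZ)).1 fun hyz => hzY ⟨y, hy, hyz⟩
  have hlt := h.card_lt_of_isCompleteTo hd hdε hY hT hcard ((filter_subset _ _).trans hZ) hcomplete
  have hsplit : (#{z ∈ Z | ∃ y ∈ Y, T.Adj y z} : ℝ) + #{z ∈ Z | ¬∃ y ∈ Y, T.Adj y z} = #Z := by
    exact_mod_cast card_filter_add_card_filter_not (s := Z) fun z => ∃ y ∈ Y, T.Adj y z
  linarith

theorem exists_isCompleteTo (h : T.IsCritical ε X) (hd : 0 < d) (hdε : 9 / 10 ≤ d ^ ε)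
    (hZ : Z ⊂ X) (hcard : d * #X ≤ #Z) :
    ∃ Y₁ ⊆ Z, ∃ Y₂ ⊆ Z, T.IsCompleteTo Y₁ Y₂ ∧
      (T.IsTransitiveOn Y₁ ∧ 3 / 10 * (#X : ℝ) ^ ε ≤ #Y₁) ∧
      T.IsTransitiveOn Y₂ ∧ 3 / 10 * (#X : ℝ) ^ ε ≤ #Y₂ := by
  classical
  obtain ⟨Y, hY, hT, hle⟩ := h.exists_isTransitiveOn hd hdε hZ hcard
  have htwo : 2 ≤ #Y := by
    have hone : (1 : ℝ) < #Y := by linarith [h.two_lt]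
    exact_mod_cast hone
  obtain ⟨Y₁, hY₁, hcard₁, hcomplete⟩ := hT.exists_isCompleteTo_sdiff (Nat.div_le_self (#Y) 2)
  have hcard₂ := card_sdiff_of_subset hY₁
  have hthird₁ : (#Y : ℝ) ≤ 3 * #Y₁ := by exact_mod_cast (by omega : #Y ≤ 3 * #Y₁)
  have hthird₂ : (#Y : ℝ) ≤ 3 * #(Y \ Y₁) := by exact_mod_cast (by omega : #Y ≤ 3 * #(Y \ Y₁))
  exact ⟨Y₁, hY₁.trans hY, Y \ Y₁, sdiff_subset.trans hY, hcomplete,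
    ⟨hT.mono hY₁, by linarith⟩, hT.mono sdiff_subset, by linarith⟩

end IsCritical

end Critical

section Boats

variable {W : Type*} {T : Tournament W} {X : Finset W} {ε d : ℝ}

theorem forall_boat_adj {b : Fin 4 → W} (h₃₀ : T.Adj (b 3) (b 0)) (h₃₁ : T.Adj (b 3) (b 1))
    (h₂₀ : T.Adj (b 2) (b 0)) (h₀₁ : T.Adj (b 0) (b 1)) (h₁₂ : T.Adj (b 1) (b 2))
    (h₂₃ : T.Adj (b 2) (b 3)) (i j : Fin 4) (hij : boat.Adj i j) : T.Adj (b i) (b j) := by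
  simp only [boat, mem_insert, mem_singleton, Prod.mk.injEq] at hij
  rcases hij with ⟨rfl, rfl⟩ | ⟨rfl, rfl⟩ | ⟨rfl, rfl⟩ | ⟨rfl, rfl⟩ | ⟨rfl, rfl⟩ | ⟨rfl, rfl⟩ <;>
    assumption

theorem boat_adj_rev (i j : Fin 4) : boat.Adj i.rev j.rev ↔ boat.Adj j i := by
  revert i j
  unfold boat
  decide

theorem IsCritical.exists_backward_arcs (h : T.IsCritical ε X) (hd : 0 < d)
    (hdε : 9 / 10 ≤ d ^ ε) {A B D : Finset W} (hA : A ⊆ X) (hB : B ⊆ X) (hD : D ⊆ X)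
    (hAB : Disjoint A B) (hBD : Disjoint B D) (hAD : Disjoint A D) (hAcard : 2 * (d * #X) ≤ #A)
    (hBcard : d * #X ≤ #B) (hDcard : 2 * (d * #X) ≤ #D) :
    ∃ x ∈ A, ∃ u ∈ B, ∃ v ∈ B, ∃ y ∈ D, T.Adj u v ∧ T.Adj y x ∧ T.Adj y u ∧ T.Adj v x := by
  classical
  have hone : 1 < d * #X := h.one_lt_mul_card hd hdε
  have hssubset {C C' : Finset W} (hC : C ⊆ X) (hC' : C' ⊆ X) (hCC' : Disjoint C C')
      (hcard : d * #X ≤ #C') : C ⊂ X := by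
    have hpos : (0 : ℝ) < #C' := by linarith
    obtain ⟨a, ha⟩ : C'.Nonempty := card_pos.1 (by exact_mod_cast hpos)
    exact (ssubset_iff_of_subset hC).2 ⟨a, hC' ha, disjoint_right.1 hCC' ha⟩
  obtain ⟨Y₁, hY₁, Y₂, hY₂, hcomplete, ⟨hT₁, hcard₁⟩, hT₂, hcard₂⟩ := h.exists_isCompleteTo hd hdε
    (hssubset hB hA hAB.symm (by linarith)) hBcard
  have hA' := h.le_card_filter_exists_adj hd hdε (hY₂.trans hB) hT₂ hcard₂ hA
    (hAB.symm.mono_left hY₂) hAcard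
  have hD' := h.reverse.le_card_filter_exists_adj hd hdε (hY₁.trans hB) hT₁.reverse hcard₁ hD
    (hBD.mono_left hY₁) hDcard
  set A' : Finset W := {x ∈ A | ∃ v ∈ Y₂, T.Adj v x}
  set D' : Finset W := {y ∈ D | ∃ u ∈ Y₁, T.reverse.Adj u y}
  have hA'A : A' ⊆ A := filter_subset _ _
  have hD'D : D' ⊆ D := filter_subset _ _
  obtain ⟨Y, hY, hT, hcard⟩ := h.exists_isTransitiveOn hd hdε
    (hssubset (hD'D.trans hD) hA (hAD.symm.mono_left hD'D) (by linarith)) hD'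
  obtain ⟨x, hx, y, hy, hxy⟩ : ∃ x ∈ A', ∃ y ∈ Y, ¬T.Adj x y := by
    by_contra! hA'Y
    exact hA'.not_gt (h.card_lt_of_isCompleteTo hd hdε (hY.trans (hD'D.trans hD)) hT
      (by linarith [h.two_lt]) (hA'A.trans hA) hA'Y)
  obtain ⟨hxA, v, hv, hvx⟩ := mem_filter.1 hx
  obtain ⟨hyD, u, hu, hyu⟩ := mem_filter.1 (hY hy)
  exact ⟨x, hxA, u, hY₁ hu, v, hY₂ hv, y, hyD, hcomplete u hu v hv,
    (not_adj_iff (disjoint_iff_ne.1 hAD x hxA y hyD)).1 hxy, hyu, hvx⟩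

theorem IsCritical.exists_boat (h : T.IsCritical ε X) (hd : 0 < d) (hdε : 9 / 10 ≤ d ^ ε)
    {A : Fin 4 → Finset W} (hA : ∀ g, A g ⊆ X) (hdisj : Pairwise (Disjoint on A))
    (hcard : ∀ g, 2 * (d * #X) ≤ #(A g))
    (hmid : ∀ x ∈ A 0, ∀ z ∈ A 2, ∀ y ∈ A 3, ∃ w ∈ A 1, T.Adj x w ∧ T.Adj w z ∧ T.Adj w y) :
    ∃ (b : Fin 4 → W) (g : Fin 4 → Fin 4), (∀ a a', boat.Adj a a' → T.Adj (b a) (b a')) ∧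
      (∀ a, b a ∈ A (g a)) ∧ ∀ a, g a = 3 ↔ a = 3 := by
  obtain ⟨x, hx, u, hu, v, hv, y, hy, huv, hyx, hyu, hvx⟩ := h.exists_backward_arcs hd hdε
    (hA 0) (hA 2) (hA 3) (hdisj (by decide)) (hdisj (by decide)) (hdisj (by decide)) (hcard 0)
    (by linarith [hcard 2, h.one_lt_mul_card hd hdε]) (hcard 3)
  have hcases : (T.Adj x u ∧ T.Adj v y) ∨ ∃ z ∈ A 2, T.Adj z x ∧ T.Adj y z := by
    have hxu := adj_or_adj (T := T)
      (disjoint_iff_ne.1 (hdisj (by decide : (0 : Fin 4) ≠ 2)) x hx u hu)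
    have hvy := adj_or_adj (T := T)
      (disjoint_iff_ne.1 (hdisj (by decide : (2 : Fin 4) ≠ 3)) v hv y hy)
    exact hxu.elim (fun hxu => hvy.imp (⟨hxu, ·⟩) fun hyv => ⟨v, hv, hvx, hyv⟩)
      fun hux => .inr ⟨u, hu, hux, hyu⟩
  rcases hcases with ⟨hxu, hvy⟩ | ⟨z, hz, hzx, hyz⟩
  · exact ⟨![x, u, v, y], ![0, 2, 2, 3], forall_boat_adj hyx hyu hvx hxu huv hvy,
      by simp [Fin.forall_fin_succ, hx, hy, hu, hv], by decide⟩
  · obtain ⟨w, hw, hxw, hwz, hwy⟩ := hmid x hx z hz y hy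
    exact ⟨![z, x, w, y], ![2, 0, 1, 3], forall_boat_adj hyz hyx hwz hzx hxw hwy,
      by simp [Fin.forall_fin_succ, hx, hy, hz, hw], by decide⟩

theorem IsCritical.exists_boat_rev (h : T.IsCritical ε X) (hd : 0 < d) (hdε : 9 / 10 ≤ d ^ ε)
    {A : Fin 4 → Finset W} (hA : ∀ g, A g ⊆ X) (hdisj : Pairwise (Disjoint on A))
    (hcard : ∀ g, 2 * (d * #X) ≤ #(A g))
    (hmid : ∀ x ∈ A 3, ∀ z ∈ A 1, ∀ y ∈ A 0, ∃ w ∈ A 2, T.Adj w x ∧ T.Adj z w ∧ T.Adj y w) :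
    ∃ (b : Fin 4 → W) (g : Fin 4 → Fin 4), (∀ a a', boat.Adj a a' → T.Adj (b a) (b a')) ∧
      (∀ a, b a ∈ A (g a)) ∧ ∀ a, g a = 0 ↔ a = 0 := by
  obtain ⟨b, g, hb, hbA, hg⟩ := h.reverse.exists_boat hd hdε (A := A ∘ Fin.rev)
    (fun g => hA g.rev) (hdisj.comp_of_injective Fin.rev_injective) (fun g => hcard g.rev) hmid
  refine ⟨b ∘ Fin.rev, Fin.rev ∘ g ∘ Fin.rev,
    fun a a' haa' => hb _ _ ((boat_adj_rev a' a).2 haa'), fun a => hbA a.rev, fun a => ?_⟩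
  have hrev := hg a.rev
  simp only [comp_apply, Fin.rev_eq_iff] at hrev ⊢
  exact hrev

end Boats

section Copies

variable {ι κ W : Type*} [LinearOrder ι]

/-- `φ` copies into `T` the relation `r`, restricted to the indices `p` with label `c p` in `P`. The
vertex `φ p` lies in the part `S (β p)`, where `β p` may differ from `p` but has to be joined to `p`
by an interval of indices with the same label. -/
structure IsPartialCopy (T : Tournament W) (r : ι → ι → Prop) (c : ι → κ) (S : ι → Finset W)
    (P : Set κ) (φ : ι → W) (β : ι → ι) : Prop where
  mem : ∀ p, c p ∈ P → φ p ∈ S (β p)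
  label_eq : ∀ p, c p ∈ P → ∀ q ∈ Set.uIcc p (β p), c q = c p
  adj : ∀ p q, c p ∈ P → c q ∈ P → r p q → T.Adj (φ p) (φ q)

variable {T : Tournament W} {r : ι → ι → Prop} {c : ι → κ} {S S' : ι → Finset W} {P Q : Set κ}
  {φ ψ : ι → W} {β γ : ι → ι} {l : ℝ}

namespace IsPartialCopy

theorem mono (h : T.IsPartialCopy r c S P φ β) (hS : S ≤ S') : T.IsPartialCopy r c S' P φ β where
  mem p hp := hS (β p) (h.mem p hp)
  label_eq := h.label_eq
  adj := h.adj

theorem disjoint_uIcc (hφ : T.IsPartialCopy r c S P φ β) (hψ : T.IsPartialCopy r c S Q ψ γ)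
    (hPQ : Disjoint P Q) {p q : ι} (hp : c p ∈ P) (hq : c q ∈ Q) :
    Disjoint (Set.uIcc p (β p)) (Set.uIcc q (γ q)) := by
  refine Set.disjoint_left.2 fun t htp htq => Set.disjoint_left.1 hPQ hp ?_
  rwa [← hφ.label_eq p hp t htp, hψ.label_eq q hq t htq]

open Classical in
theorem union (hφ : T.IsPartialCopy r c S P φ β) (hψ : T.IsPartialCopy r c S Q ψ γ)
    (hPQ : Disjoint P Q) (hr : ∀ p q, c p ≠ c q → r p q → p < q)
    (hforward : ∀ p q, c p ∈ P → c q ∈ Q → T.IsForward (β p) (γ q) (φ p) (ψ q)) :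
    T.IsPartialCopy r c S (P ∪ Q) ((c ⁻¹' P).piecewise φ ψ) ((c ⁻¹' P).piecewise β γ) := by
  have hP {p} (hp : c p ∈ P) : p ∈ c ⁻¹' P := hp
  have hQ {p} (hp : c p ∈ Q) : p ∉ c ⁻¹' P := fun hpP => Set.disjoint_left.1 hPQ hpP hp
  have hne {p q} (hp : c p ∈ P) (hq : c q ∈ Q) : c p ≠ c q :=
    fun h => hQ hq (show c q ∈ P from h ▸ hp)
  constructor
  · rintro p (hp | hp)
    · simpa only [hP hp, Set.piecewise_eq_of_mem] using hφ.mem p hp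
    · simpa only [hQ hp, not_false_eq_true, Set.piecewise_eq_of_notMem] using hψ.mem p hp
  · rintro p (hp | hp)
    · simpa only [hP hp, Set.piecewise_eq_of_mem] using hφ.label_eq p hp
    · simpa only [hQ hp, not_false_eq_true, Set.piecewise_eq_of_notMem] using hψ.label_eq p hp
  · rintro p q (hp | hp) (hq | hq) hpq
    · simpa only [hP hp, hP hq, Set.piecewise_eq_of_mem] using hφ.adj p q hp hq hpq
    · have hlt := lt_of_disjoint_uIcc (hφ.disjoint_uIcc hψ hPQ hp hq) (hr p q (hne hp hq) hpq)
      simpa only [hP hp, hQ hq, not_false_eq_true, Set.piecewise_eq_of_mem,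
        Set.piecewise_eq_of_notMem] using (hforward p q hp hq).1 hlt
    · have hlt := lt_of_disjoint_uIcc (hφ.disjoint_uIcc hψ hPQ hq hp).symm
        (hr p q (hne hq hp).symm hpq)
      simpa only [hQ hp, hP hq, not_false_eq_true, Set.piecewise_eq_of_mem,
        Set.piecewise_eq_of_notMem] using (hforward q p hq hp).2 hlt
    · simpa only [hQ hp, hQ hq, not_false_eq_true, Set.piecewise_eq_of_notMem] using
        hψ.adj p q hp hq hpq

end IsPartialCopy

theorem IsSmooth.exists_forward_subsets [Fintype ι] (h : T.IsSmooth S l) (hl : 0 ≤ l)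
    (hφ : T.IsPartialCopy r c S P φ β) :
    ∃ S' ≤ S, (∀ j, (1 - Fintype.card ι * l) * #(S j) ≤ #(S' j)) ∧
      ∀ p, c p ∈ P → ∀ j, ∀ w ∈ S' j, T.IsForward (β p) j (φ p) w := by
  classical
  let I : Finset ι := {p | c p ∈ P}
  let F : Finset (ι × W) := I.image fun p => (β p, φ p)
  have hF : ∀ x ∈ F, x.2 ∈ S x.1 := forall_mem_image.2 fun p hp => hφ.mem p (mem_filter.1 hp).2
  have hFcard : #F ≤ Fintype.card ι := card_image_le.trans (card_le_univ _)
  let S' (j : ι) : Finset W := {w ∈ S j | ∀ x ∈ F, T.IsForward x.1 j x.2 w}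
  refine ⟨S', fun j => filter_subset _ _, fun j => ?_, fun p hp j w hw => ?_⟩
  · have hremoved : (#(S j \ S' j) : ℝ) ≤ #F * (l * #(S j)) :=
      h.card_le_of_forall_exists_not_isForward hF sdiff_subset fun w hw => by
        obtain ⟨hwS, hwS'⟩ := mem_sdiff.1 hw
        by_contra! hforward
        exact hwS' (mem_filter.2 ⟨hwS, hforward⟩)
    have hsplit : (#(S j) : ℝ) ≤ #(S j \ S' j) + #(S' j) := by
      exact_mod_cast card_le_card_sdiff_add_card
    have hbound : (#F : ℝ) * (l * #(S j)) ≤ Fintype.card ι * (l * #(S j)) := by gcongr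
    linarith
  · exact (mem_filter.1 hw).2 (β p, φ p) (mem_image_of_mem _ (mem_filter.2 ⟨mem_univ p, hp⟩))

/-- Labels are copied one at a time, after pruning each part to the vertices that are forward to all
vertices chosen before. -/
theorem IsSmooth.exists_map [Fintype ι] [Nonempty W] (h : T.IsSmooth S l) (hl : 0 ≤ l)
    (hr : ∀ p q, c p ≠ c q → r p q → p < q)
    (hcopy : ∀ S' ≤ S, (∀ j, (1 - Fintype.card ι * l) * #(S j) ≤ #(S' j)) →
      ∀ C, ∃ φ β, T.IsPartialCopy r c S' {C} φ β) :
    ∃ φ : ι → W, ∀ p q, r p q → T.Adj (φ p) (φ q) := by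
  classical
  suffices ∃ φ β, T.IsPartialCopy r c S (Set.range c) φ β by
    obtain ⟨φ, β, hφ⟩ := this
    exact ⟨φ, fun p q => hφ.adj p q ⟨p, rfl⟩ ⟨q, rfl⟩⟩
  induction Set.range c, Set.finite_range c using Set.Finite.induction_on with
  | empty =>
    exact ⟨fun _ => Classical.arbitrary W, id, by simp, by simp, by simp⟩
  | @insert C P hC _ ih =>
    obtain ⟨φ, β, hφ⟩ := ih
    obtain ⟨S', hS', hcard, hforward⟩ := h.exists_forward_subsets hl hφ
    obtain ⟨ψ, γ, hψ⟩ := hcopy S' hS' hcard C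
    rw [Set.insert_eq, Set.union_comm]
    exact ⟨_, _, hφ.union (hψ.mono hS') (Set.disjoint_singleton_right.2 hC) hr
      fun p q hp hq => hforward p hp (γ q) (ψ q) (hψ.mem q hq)⟩

end Copies

section Flotillas

variable {V W : Type*} {H : Tournament V} {n : ℕ} {θ : Fin n ≃ V} {i : Fin 4 → Fin n}

/-- The connected component of `B(H, θ)` containing the vertex in position `p`. -/
def component (H : Tournament V) (θ : Fin n ≃ V) (p : Fin n) :
    (H.backwardGraph θ).ConnectedComponent :=
  (H.backwardGraph θ).connectedComponentMk (θ p)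

theorem backwardGraph_adj_of_lt {a b : V} (hab : θ.symm a < θ.symm b) :
    (H.backwardGraph θ).Adj a b ↔ H.Adj b a := by
  simp [backwardGraph, hab, hab.not_gt]

theorem lt_of_adj_of_component_ne {p q : Fin n} (hpq : H.component θ p ≠ H.component θ q)
    (h : H.Adj (θ p) (θ q)) : p < q := by
  by_contra! hle
  obtain rfl | hlt := hle.eq_or_lt
  · exact H.irrefl _ h
  · have hadj : (H.backwardGraph θ).Adj (θ q) (θ p) := (backwardGraph_adj_of_lt (by simpa)).2 h
    exact hpq (SimpleGraph.ConnectedComponent.connectedComponentMk_eq_of_adj hadj.symm)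

theorem IsBoatAt.boat_adj (h : H.IsBoatAt θ i) {a b : Fin 4} (hab : H.Adj (θ (i a)) (θ (i b))) :
    boat.Adj a b := by
  have hback {a b} (hlt : a < b) : H.Adj (θ (i b)) (θ (i a)) ↔ boat.Adj b a := by
    rw [← backwardGraph_adj_of_lt (θ := θ) (by simpa using h.1 hlt), h.2,
      backwardGraph_adj_of_lt (by simpa using hlt)]
  rcases lt_trichotomy a b with hlt | rfl | hlt
  · exact (not_adj_iff hlt.ne').1 fun hba => adj_asymm hab ((hback hlt).2 hba)
  · exact absurd hab (H.irrefl _)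
  · exact (hback hlt).1 hab

variable {T : Tournament W} {S : Fin n → Finset W} {C : (H.backwardGraph θ).ConnectedComponent}

theorem IsBoatAt.exists_isPartialCopy (h : H.IsBoatAt θ i)
    (hC : C.supp = Set.range fun a => θ (i a)) {e : Fin 4} (he : (i '' {e}ᶜ).OrdConnected)
    {b : Fin 4 → W} (hb : ∀ a a', boat.Adj a a' → T.Adj (b a) (b a')) {g : Fin 4 → Fin 4}
    (hbS : ∀ a, b a ∈ S (i (g a))) (hg : ∀ a, g a = e ↔ a = e) :
    ∃ φ β, T.IsPartialCopy (fun p q => H.Adj (θ p) (θ q)) (H.component θ) S {C} φ β := by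
  have hinj : Injective i := h.1.injective
  have hcomponent (p) : H.component θ p = C ↔ p ∈ Set.range i := by
    have hsupp : H.component θ p = C ↔ θ p ∈ C.supp := Iff.rfl
    simp [hsupp, hC]
  refine ⟨extend i b fun _ => b 0, extend i (i ∘ g) id, ?_, ?_, ?_⟩ <;>
    simp only [Set.mem_singleton_iff, hcomponent]
  · rintro _ ⟨a, rfl⟩
    simpa only [hinj.extend_apply, comp_apply] using hbS a
  · rintro _ ⟨a, rfl⟩ q hq
    rw [hinj.extend_apply] at hq
    rw [(hcomponent (i a)).2 ⟨a, rfl⟩, hcomponent]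
    by_cases ha : a = e
    · rw [comp_apply, (hg a).2 ha, ha, Set.uIcc_self, Set.mem_singleton_iff] at hq
      exact ⟨e, hq.symm⟩
    · exact Set.image_subset_range _ _ (he.uIcc_subset (Set.mem_image_of_mem i ha)
        (Set.mem_image_of_mem i fun hga => ha ((hg a).1 hga)) hq)
  · rintro _ _ ⟨a, rfl⟩ ⟨a', rfl⟩ hadj
    simpa only [hinj.extend_apply] using hb a a' (h.boat_adj hadj)

theorem ordConnected_image_compl_last (hi : StrictMono i) (h₁ : (i 1 : ℕ) = i 0 + 1)
    (h₂ : (i 2 : ℕ) = i 1 + 1) : (i '' {3}ᶜ).OrdConnected := by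
  convert Set.ordConnected_Icc (a := i 0) (b := i 2)
  ext q
  constructor
  · rintro ⟨a, ha, rfl⟩
    have ha : a ≠ 3 := ha
    exact ⟨hi.monotone (Fin.zero_le a), hi.monotone (by omega)⟩
  · rintro ⟨h₀q, hq₂⟩
    obtain rfl | rfl | rfl : i 0 = q ∨ i 1 = q ∨ i 2 = q := by omega
    all_goals exact Set.mem_image_of_mem i (by decide)

theorem ordConnected_image_compl_zero (hi : StrictMono i) (h₂ : (i 2 : ℕ) = i 1 + 1)
    (h₃ : (i 3 : ℕ) = i 2 + 1) : (i '' {0}ᶜ).OrdConnected := by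
  convert Set.ordConnected_Icc (a := i 1) (b := i 3)
  ext q
  constructor
  · rintro ⟨a, ha, rfl⟩
    have ha : a ≠ 0 := ha
    exact ⟨hi.monotone (by omega), hi.monotone (by omega)⟩
  · rintro ⟨h₁q, hq₃⟩
    obtain rfl | rfl | rfl : i 1 = q ∨ i 2 = q ∨ i 3 = q := by omega
    all_goals exact Set.mem_image_of_mem i (by decide)

variable {X : Finset W} {ε d l : ℝ}

theorem IsCritical.exists_isPartialCopy (h : T.IsCritical ε X) (hd : 0 < d)
    (hdε : 9 / 10 ≤ d ^ ε) (hC : H.IsLeftBoat θ C.supp ∨ H.IsRightBoat θ C.supp)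
    (hSX : ∀ p, S p ⊆ X) (hdisj : Pairwise (Disjoint on S)) (hcard : ∀ p, 2 * (d * #X) ≤ #(S p))
    (hmid : ∀ p q r m, ∀ x ∈ S p, ∀ z ∈ S q, ∀ y ∈ S r,
      ∃ w ∈ S m, T.IsForward p m x w ∧ T.IsForward q m z w ∧ T.IsForward r m y w) :
    ∃ φ β, T.IsPartialCopy (fun p q => H.Adj (θ p) (θ q)) (H.component θ) S {C} φ β := by
  rcases hC with ⟨i, hCi, hi, h₁, h₂⟩ | ⟨i, hCi, hi, h₂, h₃⟩
  · obtain ⟨b, g, hb, hbS, hg⟩ := h.exists_boat hd hdε (A := S ∘ i) (fun g => hSX (i g))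
      (hdisj.comp_of_injective hi.1.injective) (fun g => hcard (i g)) fun x hx z hz y hy => by
        obtain ⟨w, hw, hxw, hzw, hyw⟩ := hmid (i 0) (i 2) (i 3) (i 1) x hx z hz y hy
        exact ⟨w, hw, hxw.1 (hi.1 (by decide)), hzw.2 (hi.1 (by decide)),
          hyw.2 (hi.1 (by decide))⟩
    exact hi.exists_isPartialCopy hCi (ordConnected_image_compl_last hi.1 h₁ h₂) hb hbS hg
  · obtain ⟨b, g, hb, hbS, hg⟩ := h.exists_boat_rev hd hdε (A := S ∘ i) (fun g => hSX (i g))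
      (hdisj.comp_of_injective hi.1.injective) (fun g => hcard (i g)) fun x hx z hz y hy => by
        obtain ⟨w, hw, hxw, hzw, hyw⟩ := hmid (i 3) (i 1) (i 0) (i 2) x hx z hz y hy
        exact ⟨w, hw, hxw.2 (hi.1 (by decide)), hzw.1 (hi.1 (by decide)),
          hyw.1 (hi.1 (by decide))⟩
    exact hi.exists_isPartialCopy hCi (ordConnected_image_compl_zero hi.1 h₂ h₃) hb hbS hg

theorem IsCritical.contains_of_isFlotillaOrdering (h : T.IsCritical ε X) (hd : 0 < d)
    (hdε : 9 / 10 ≤ d ^ ε) (hθ : H.IsFlotillaOrdering θ)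
    (hS : ∀ p, S p ⊆ X ∧ 4 * (d * #X) ≤ #(S p)) (hdisj : Pairwise (Disjoint on S))
    (hsmooth : T.IsSmooth S l) (hl₀ : 0 ≤ l) (hl : 2 * (n + 4) * l ≤ 1) : T.Contains H := by
  have hdX : 1 < d * #X := h.one_lt_mul_card hd hdε
  have hXpos : (0 : ℝ) < #X := pos_of_mul_pos_right (one_pos.trans hdX) hd.le
  have : Nonempty W := (card_pos.1 (by exact_mod_cast hXpos)).to_type
  obtain ⟨φ, hφ⟩ := hsmooth.exists_map hl₀ (r := fun p q => H.Adj (θ p) (θ q))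
    (c := H.component θ) (fun _ _ => lt_of_adj_of_component_ne) fun S' hS' hcard C => by
      rw [Fintype.card_fin] at hcard
      refine h.exists_isPartialCopy hd hdε (hθ C) (fun p => (hS' p).trans (hS p).1)
        (fun p q hpq => (hdisj hpq).mono (hS' p) (hS' q))
        (fun p => by nlinarith [hcard p, (hS p).2]) fun p q r m x hx z hz y hy =>
          hsmooth.exists_isForward_three hl₀ (hS' p hx) (hS' q hz) (hS' r hy) (hS' m)
            (by nlinarith [hcard m, (hS m).2])
  exact contains_of_forall_adj (φ ∘ θ.symm) fun a b hab => hφ _ _ (by simpa using hab)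

theorem IsFlotillaOrdering.satisfiesEHC {V : Type u} {H : Tournament V} {θ : Fin n ≃ V}
    (hθ : H.IsFlotillaOrdering θ) : SatisfiesEHC.{u, v} H := by
  have : Finite V := .of_equiv _ θ
  set l : ℝ := 1 / (2 * (n + 4)) with hl
  have hl₀ : 0 < l := by positivity
  have hl₁ : 2 * (n + 4) * l = 1 := by
    rw [hl]
    field_simp
  obtain ⟨c, hc₀, hc₁, hsmooth⟩ := exists_isSmooth H n hl₀ (by nlinarith)
  obtain ⟨d, rfl⟩ : ∃ d, c = 4 * d := ⟨c / 4, by ring⟩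
  have hd₀ : 0 < d := by linarith
  have hd₁ : d < 1 := by linarith
  have hε : 0 < Real.logb d (9 / 10) :=
    Real.logb_pos_of_base_lt_one hd₀ hd₁ (by norm_num) (by norm_num)
  have hdε : d ^ Real.logb d (9 / 10) = 9 / 10 := Real.rpow_logb hd₀ hd₁.ne (by norm_num)
  refine ⟨_, hε, fun W _ T hT => ?_⟩
  by_contra! hsmall
  obtain ⟨X, hX⟩ := exists_isCritical hε fun Y hY => hsmall Y hY.isTransitive_induce
  have hdX : 1 < d * #X := hX.one_lt_mul_card hd₀ hdε.ge
  obtain ⟨S, hS, hdisj, hSsmooth⟩ := hsmooth T hT X (by linarith)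
  exact hT (hX.contains_of_isFlotillaOrdering hd₀ hdε.ge hθ
    (fun p => ⟨(hS p).1, by linarith [(hS p).2]⟩) hdisj hSsmooth hl₀.le hl₁.le)

end Flotillas

end Tournament

end FlotillaEHC

theorem mainTheorem2 {V : Type u} [Fintype V] (H : FlotillaEHC.Tournament V)
    (hH : H.IsFlotilla) : FlotillaEHC.Tournament.SatisfiesEHC.{u, v} H := by
  obtain ⟨θ, hθ⟩ := hH
  exact hθ.satisfiesEHC
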